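/- Let $\mathbb{D}=\{z\in\mathbb{C}:|z|<1\}$ and let $f(z)=\sum_{n=0}^\infty a_nz^n$ be a non-constant analytic function on $\mathbb{D}$. For $0\le r<1$ put $\mu_f(r)=\max_{n\ge 0}|a_n|r^n$ and $S_f(r)=\big(\sum_{n=0}^\infty|a_n|^2r^{2n}\big)^{1/2}$. Let $(X_n)_{n\ge 0}$ be a sequence of independent complex random variables on a probability space $(\Omega,\mathcal{A},\mathbb{P})$ that is centred, that is, $\mathbb{E}(X_n)=0$ for all $n\ge 0$, and subgaussian, that is, there are constants $K,\tau>0$ such that $\mathbb{P}(|X_n|>t)\le Ke^{-t^2/\tau^2}$ for all $n\ge 0$ and all $t\ge 0$. Then, almost surely, $\sum_{n=0}^\infty a_nX_nz^n$ converges for every $z\in\mathbb{D}$ and defines an analytic function on $\mathbb{D}$. Moreover, there exist an open set $E\subset[0,1)$ of finite logarithmic measure, that is, $\int_E\frac{1}{1-r}\,dr<\infty$, and a constant $C>0$ such that, almost surely, there exists some $r_0\in(0,1)$ such that \[ \max_{|z|=r}\Big|\sum_{n=0}^{\infty}a_nX_nz^n\Big| \leq C\sqrt{\log\Big(\frac{1}{1-r}\log\frac{\mu_f(r)}{1-r}\Big)}\;S_f(r)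 \] for all $r$ with $r_0\leq r<1$ and $r\notin E$. -/

import Mathlib

open MeasureTheory ProbabilityTheory Metric Set

/-- The maximum term `μ_f(r) = max_{n ≥ 0} |a_n| r^n` of `f(z) = ∑ a_n z^n`. If the series converges
in the unit disk and `0 ≤ r < 1`, the terms tend to `0`, so that the supremum is attained. -/
noncomputable def maxTerm (a : ℕ → ℂ) (r : ℝ) : ℝ :=
  ⨆ n : ℕ, ‖a n‖ * r ^ n

/-- The quadratic mean `S_f(r) = (∑ |a_n|² r^{2n})^{1/2}` of `f(z) = ∑ a_n z^n`. -/
noncomputable def quadMean (a : ℕ → ℂ) (r : ℝ) : ℝ :=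
  Real.sqrt (∑' n : ℕ, ‖a n‖ ^ 2 * r ^ (2 * n))

/-- The maximum modulus `max_{|z| = r} |F(z)|`; the supremum is attained as soon as `F` is
continuous on the circle and `0 ≤ r`. -/
noncomputable def maxModulus (F : ℂ → ℂ) (r : ℝ) : ℝ :=
  sSup ((fun z => ‖F z‖) '' sphere (0 : ℂ) r)

/-- The sum `z ↦ ∑ a_n X_n(ω) z^n` of the random power series at the outcome `ω`. -/
noncomputable def randomSeries {Ω : Type*} (a : ℕ → ℂ) (X : ℕ → Ω → ℂ) (ω : Ω) (z : ℂ) : ℂ :=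
  ∑' n : ℕ, a n * X n ω * z ^ n

/-- A set `E ⊆ [0,1)` is of finite logarithmic measure if `∫_E dr / (1 - r) < ∞`. -/
def FiniteLogMeasure (E : Set ℝ) : Prop :=
  ∫⁻ r in E, ENNReal.ofReal (1 / (1 - r)) < ⊤

/-- A sequence of random variables is subgaussian if there are constants `K, τ > 0`, the same for
all `n`, with `P(|X_n| > t) ≤ K exp(-t²/τ²)` for all `t ≥ 0`. -/
def SubgaussianSeq {Ω : Type*} [MeasurableSpace Ω] (X : ℕ → Ω → ℂ) (P : Measure Ω) : Prop :=
  ∃ K τ : ℝ, 0 < K ∧ 0 < τ ∧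
    ∀ n : ℕ, ∀ t : ℝ, 0 ≤ t → P.real {ω | t < ‖X n ω‖} ≤ K * Real.exp (-t ^ 2 / τ ^ 2)

/-- A sequence of random variables is centred if each of them has mean zero. -/
def CentredSeq {Ω : Type*} [MeasurableSpace Ω] (X : ℕ → Ω → ℂ) (P : Measure Ω) : Prop :=
  ∀ n : ℕ, Integrable (X n) P ∧ ∫ ω, X n ω ∂P = 0

/-! Put `T = log(μ_f(r)/(1-r))` and `L = T/(1-r)`. Outside a small set of radii only terms of order
up to about `16L²` matter, and a random polynomial with `N` terms is `O(√log N)` times its quadratic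
mean; for `N` about `16L²`, `log N = O(log L)`.

Probability: at a fixed point, independent centred subgaussian variables give Gaussian tails
(`exists_measureReal_norm_sum_le`). A union bound over a lattice of polynomial size and
Borel–Cantelli cover all large `N` at once, and `norm_sum_le_of_perturbation` passes from the
lattice to an annulus (`ae_eventually_norm_sum_le`). Since all large `N` are covered simultaneously,
`N` may afterwards depend on `r`.

Analysis: the growth lemma `exists_growth_exceptional_set`, applied to `T`, bounds `μ_f` at a radius
slightly beyond `r`; the geometric decay between the two radii makes the terms beyond `16L²` at most
`e^{-√n}` (`exists_exceptional_set_terms_le`). `eventually_maxModulus_le` joins the two halves. -/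

/-! ### Subgaussian deviation inequalities. -/

lemma exp_le_add_exp_sq (x : ℝ) : Real.exp x ≤ x + Real.exp (x ^ 2) := by
  rcases le_or_gt |x| 1 with h | h
  · have h1 := (abs_le.1 (Real.abs_exp_sub_one_sub_id_le h)).2
    have h2 := Real.add_one_le_exp (x ^ 2)
    linarith
  · rcases lt_abs.1 h with h | h
    · have : Real.exp x ≤ Real.exp (x ^ 2) := Real.exp_le_exp.2 (by nlinarith)
      linarith
    · have h1 : Real.exp x ≤ 1 := Real.exp_le_one_iff.2 (by linarith)
      have h2 := Real.add_one_le_exp (x ^ 2)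
      nlinarith

/-- Convexity of the exponential on a segment starting at `0`. -/
lemma exp_mul_le_one_add_mul {θ : ℝ} (h0 : 0 ≤ θ) (h1 : θ ≤ 1) (v : ℝ) :
    Real.exp (θ * v) ≤ 1 + θ * (Real.exp v - 1) := by
  have := convexOn_exp.2 (mem_univ (0 : ℝ)) (mem_univ v) (sub_nonneg.2 h1) h0 (by ring)
  simp only [smul_eq_mul, mul_zero, zero_add, Real.exp_zero, mul_one] at this
  linarith

section Subgaussian

variable {Ω : Type*} [MeasurableSpace Ω] {P : Measure Ω}

/-- A nonnegative random variable with tails `P(Z > t) ≤ K exp(-2t)` has `E(exp Z) ≤ 1 + K`. -/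
lemma integrable_exp_of_tail [IsProbabilityMeasure P] {Z : Ω → ℝ} {K : ℝ} (hK : 0 ≤ K)
    (hZ : Measurable Z) (hZ0 : ∀ ω, 0 ≤ Z ω)
    (htail : ∀ t : ℝ, 0 ≤ t → P.real {ω | t < Z ω} ≤ K * Real.exp (-(2 * t))) :
    Integrable (fun ω => Real.exp (Z ω)) P ∧ ∫ ω, Real.exp (Z ω) ∂P ≤ 1 + K := by
  have key : ∫⁻ ω, ENNReal.ofReal (Real.exp (Z ω) - 1) ∂P ≤ ENNReal.ofReal K := by
    -- Layer cake: `E(e^Z - 1) = ∫ P(Z > t) e^t dt`. The rate `2` in the tail leaves `∫ K e^{-t} dt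
    -- = K`.
    have h := lintegral_comp_eq_lintegral_meas_lt_mul P (f := Z) (g := Real.exp)
      (Filter.Eventually.of_forall hZ0) hZ.aemeasurable
      (fun t _ => Real.continuous_exp.intervalIntegrable _ _)
      (Filter.Eventually.of_forall fun t => (Real.exp_pos t).le)
    simp only [integral_exp, Real.exp_zero] at h
    rw [h]
    calc ∫⁻ t in Ioi (0 : ℝ), P {a | t < Z a} * ENNReal.ofReal (Real.exp t)
        ≤ ∫⁻ t in Ioi (0 : ℝ), ENNReal.ofReal (K * Real.exp (-t)) := by
          refine setLIntegral_mono' measurableSet_Ioi fun t ht => ?_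
          have h1 : P {a | t < Z a} ≤ ENNReal.ofReal (K * Real.exp (-(2 * t))) := by
            rw [← ofReal_measureReal]
            exact ENNReal.ofReal_le_ofReal (htail t (le_of_lt ht))
          refine (mul_le_mul_left h1 _).trans ?_
          rw [← ENNReal.ofReal_mul (by positivity), mul_assoc, ← Real.exp_add]
          exact le_of_eq (by ring_nf)
      _ = ENNReal.ofReal K := by
          rw [← ofReal_integral_eq_lintegral_ofReal]
          · rw [integral_const_mul, integral_exp_neg_Ioi_zero, mul_one]
          · exact (integrableOn_exp_neg_Ioi 0).const_mul K
          · exact Filter.Eventually.of_forall fun t => by positivity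
  have hnn : ∀ ω, 0 ≤ Real.exp (Z ω) - 1 := fun ω => by
    linarith [Real.one_le_exp (hZ0 ω)]
  have hint : Integrable (fun ω => Real.exp (Z ω) - 1) P := by
    refine ⟨(by fun_prop : Measurable fun ω => Real.exp (Z ω) - 1).aestronglyMeasurable, ?_⟩
    rw [hasFiniteIntegral_iff_ofReal (Filter.Eventually.of_forall hnn)]
    exact key.trans_lt ENNReal.ofReal_lt_top
  have hint' : Integrable (fun ω => Real.exp (Z ω)) P := by
    exact (hint.add (integrable_const (1 : ℝ))).congr (Filter.Eventually.of_forall fun ω => by simp)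
  refine ⟨hint', ?_⟩
  have h2 : ∫ ω, (Real.exp (Z ω) - 1) ∂P ≤ K := by
    rw [integral_eq_lintegral_of_nonneg_ae (Filter.Eventually.of_forall hnn)
      hint.aestronglyMeasurable]
    exact ENNReal.toReal_le_of_le_ofReal hK key
  rw [integral_sub hint' (integrable_const _)] at h2
  simp at h2
  linarith

/-- A centred real random variable `Y` for which `l * Y ^ 2` is dominated by a variable with an
exponential moment has a subgaussian moment generating function. -/
lemma hasSubgaussianMGF_of_exp_sq [IsProbabilityMeasure P] {Y V : Ω → ℝ} {K l : ℝ}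
    (hK : 0 ≤ K) (hl : 0 < l) (hY : Measurable Y) (hYi : Integrable Y P) (hY0 : ∫ ω, Y ω ∂P = 0)
    (hYV : ∀ ω, l * Y ω ^ 2 ≤ V ω) (hV : Integrable (fun ω => Real.exp (V ω)) P)
    (hVK : ∫ ω, Real.exp (V ω) ∂P ≤ 1 + K) :
    HasSubgaussianMGF Y (Real.toNNReal (2 * (K + 1) / l)) P := by
  have bound (s : ℝ) (ω : Ω) :
      Real.exp (s * Y ω) ≤ Real.exp (s ^ 2 / (4 * l)) * Real.exp (V ω) := by
    rw [← Real.exp_add, Real.exp_le_exp]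
    have h1 : s ^ 2 / (4 * l) + l * Y ω ^ 2 - s * Y ω = (s - 2 * l * Y ω) ^ 2 / (4 * l) := by
      field_simp; ring
    have h2 : 0 ≤ (s - 2 * l * Y ω) ^ 2 / (4 * l) := by positivity
    linarith [hYV ω]
  have hint (s : ℝ) : Integrable (fun ω => Real.exp (s * Y ω)) P := by
    refine (hV.const_mul (Real.exp (s ^ 2 / (4 * l)))).mono'
      (by fun_prop : Measurable fun ω => Real.exp (s * Y ω)).aestronglyMeasurable ?_
    refine Filter.Eventually.of_forall fun ω => ?_
    rw [Real.norm_eq_abs, Real.abs_exp]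
    exact bound s ω
  refine ⟨hint, fun s => ?_⟩
  have hc : (Real.toNNReal (2 * (K + 1) / l) : ℝ) * s ^ 2 / 2 = s ^ 2 / l * (K + 1) := by
    rw [Real.coe_toNNReal _ (by positivity)]
    field_simp
  rw [hc, mgf]
  have hsl : 0 ≤ s ^ 2 / l := by positivity
  -- For small `s` centring is essential: it kills the linear term of `e^x ≤ x + e^{x²}`. For large
  -- `s` the completed square in `bound` suffices, the factor `1 + K` being absorbed by `e^{K
  -- s²/l}`.
  rcases le_total (s ^ 2 / l) 1 with h | h
  · have hp : ∀ ω, Real.exp (s * Y ω) ≤ s * Y ω + (1 + s ^ 2 / l * (Real.exp (V ω) - 1)) := by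
      intro ω
      refine (exp_le_add_exp_sq _).trans (add_le_add le_rfl ?_)
      refine le_trans (Real.exp_le_exp.2 ?_) (exp_mul_le_one_add_mul hsl h (V ω))
      calc (s * Y ω) ^ 2 = s ^ 2 / l * (l * Y ω ^ 2) := by field_simp
        _ ≤ _ := mul_le_mul_of_nonneg_left (hYV ω) hsl
    have i1 : Integrable (fun ω => s * Y ω) P := hYi.const_mul s
    have i3 : Integrable (fun ω => Real.exp (V ω) - 1) P := hV.sub (integrable_const _)
    have i2 : Integrable (fun ω => 1 + s ^ 2 / l * (Real.exp (V ω) - 1)) P :=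
      (integrable_const _).add (i3.const_mul _)
    calc ∫ ω, Real.exp (s * Y ω) ∂P
        ≤ ∫ ω, (s * Y ω + (1 + s ^ 2 / l * (Real.exp (V ω) - 1))) ∂P :=
          integral_mono (hint s) (i1.add i2) hp
      _ = 1 + s ^ 2 / l * (∫ ω, Real.exp (V ω) ∂P - 1) := by
          rw [integral_add i1 i2, integral_const_mul, hY0,
            integral_add (integrable_const _) (i3.const_mul _), integral_const_mul,
            integral_sub hV (integrable_const _)]
          simp
      _ ≤ 1 + s ^ 2 / l * (K + 1) := by
          gcongr
          linarith
      _ ≤ _ := by linarith [Real.add_one_le_exp (s ^ 2 / l * (K + 1))]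
  · calc ∫ ω, Real.exp (s * Y ω) ∂P
        ≤ ∫ ω, Real.exp (s ^ 2 / (4 * l)) * Real.exp (V ω) ∂P :=
          integral_mono (hint s) (hV.const_mul _) (bound s)
      _ = Real.exp (s ^ 2 / (4 * l)) * ∫ ω, Real.exp (V ω) ∂P := integral_const_mul _ _
      _ ≤ Real.exp (s ^ 2 / l) * Real.exp (s ^ 2 / l * K) := by
          gcongr
          · linarith
          · refine hVK.trans ?_
            have := Real.add_one_le_exp (s ^ 2 / l * K)
            nlinarith
      _ = _ := by rw [← Real.exp_add]; ring_nf

/-- Centred subgaussian complex variables: the real parts of their multiples have subgaussian moment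
generating functions with a uniform constant. -/
lemma exists_hasSubgaussianMGF_re [IsProbabilityMeasure P] {X : ℕ → Ω → ℂ}
    (hXm : ∀ n, Measurable (X n)) (hXc : CentredSeq X P) (hXs : SubgaussianSeq X P) :
    ∃ κ : ℝ, 0 < κ ∧ ∀ (n : ℕ) (c : ℂ),
      HasSubgaussianMGF (fun ω => (c * X n ω).re) (Real.toNNReal (κ * ‖c‖ ^ 2)) P := by
  obtain ⟨K, τ, hK, hτ, htail⟩ := hXs
  refine ⟨2 * (K + 1) * (2 * τ ^ 2), by positivity, fun n c => ?_⟩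
  rcases eq_or_ne c 0 with rfl | hc
  · simp
  have hcn : 0 < ‖c‖ := norm_pos_iff.2 hc
  have hm : Measurable fun ω => ‖X n ω‖ ^ 2 / (2 * τ ^ 2) :=
    ((hXm n).norm.pow_const 2).div_const _
  -- Halving `|X|²/τ²` turns the tail `e^{-t²/τ²}` of `|X|` into the required `e^{-2t}`.
  obtain ⟨hV, hVK⟩ := integrable_exp_of_tail (P := P) hK.le hm (fun ω => by positivity) (by
    intro t ht
    have heq : {ω | t < ‖X n ω‖ ^ 2 / (2 * τ ^ 2)} = {ω | Real.sqrt (t * (2 * τ ^ 2)) < ‖X n ω‖} := by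
      ext ω
      rw [mem_ofPred_eq, mem_ofPred_eq, lt_div_iff₀ (by positivity),
        Real.sqrt_lt (by positivity) (norm_nonneg _)]
    rw [heq]
    refine (htail n _ (Real.sqrt_nonneg _)).trans (le_of_eq ?_)
    rw [Real.sq_sqrt (by positivity)]
    congr 2
    field_simp)
  have hi : Integrable (fun ω => c * X n ω) P := (hXc n).1.const_mul c
  have := hasSubgaussianMGF_of_exp_sq (P := P) (Y := fun ω => (c * X n ω).re) (K := K)
    (V := fun ω => ‖X n ω‖ ^ 2 / (2 * τ ^ 2)) (l := (2 * τ ^ 2 * ‖c‖ ^ 2)⁻¹) hK.le (by positivity)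
    (Complex.measurable_re.comp ((hXm n).const_mul c)) hi.re
    (by
      have h := integral_re hi
      simp only [RCLike.re_eq_complex_re] at h
      rw [h, integral_const_mul, (hXc n).2]; simp)
    (fun ω => by
      have h1 : (c * X n ω).re ^ 2 ≤ ‖c‖ ^ 2 * ‖X n ω‖ ^ 2 := by
        rw [← mul_pow, ← norm_mul, ← sq_abs]
        gcongr
        exact Complex.abs_re_le_norm _
      rw [inv_mul_le_iff₀ (by positivity)]
      refine h1.trans (le_of_eq ?_)
      field_simp)
    hV hVK
  convert this using 2
  field_simp

/-- Since `|w| ≤ |Re w| + |Im w|`, real one-sided bounds in four directions control a complex sum;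
hence the factors `2` and `4` in the deviation inequality. -/
lemma exists_rotation_re_ge {w : ℂ} {ε : ℝ} (h : 2 * ε ≤ ‖w‖) :
    ε ≤ ((1 : ℂ) * w).re ∨ ε ≤ ((-1 : ℂ) * w).re ∨ ε ≤ (Complex.I * w).re ∨
      ε ≤ (-Complex.I * w).re := by
  have h1 := Complex.norm_le_abs_re_add_abs_im w
  simp only [one_mul, neg_mul, Complex.neg_re, Complex.I_mul_re]
  rcases abs_cases w.re with ⟨h2, _⟩ | ⟨h2, _⟩ <;> rcases abs_cases w.im with ⟨h3, _⟩ | ⟨h3, _⟩ <;>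
    by_contra! hcon <;> obtain ⟨_, _, _, _⟩ := hcon <;> linarith

/-- Deviation inequality for linear combinations of centred independent subgaussian complex
variables. -/
lemma exists_measureReal_norm_sum_le [IsProbabilityMeasure P] {X : ℕ → Ω → ℂ}
    (hXm : ∀ n, Measurable (X n)) (hXi : iIndepFun X P)
    (hXc : CentredSeq X P) (hXs : SubgaussianSeq X P) :
    ∃ κ : ℝ, 0 < κ ∧ ∀ (s : Finset ℕ) (c : ℕ → ℂ) (t : ℝ), 0 ≤ t →
      P.real {ω | 2 * t * Real.sqrt (∑ n ∈ s, ‖c n‖ ^ 2) < ‖∑ n ∈ s, c n * X n ω‖} ≤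
        4 * Real.exp (-t ^ 2 / (2 * κ)) := by
  obtain ⟨κ, hκ, hsub⟩ := exists_hasSubgaussianMGF_re hXm hXc hXs
  refine ⟨κ, hκ, fun s c t ht => ?_⟩
  set σ := Real.sqrt (∑ n ∈ s, ‖c n‖ ^ 2) with hσ
  have hσ2 : σ ^ 2 = ∑ n ∈ s, ‖c n‖ ^ 2 := Real.sq_sqrt (Finset.sum_nonneg fun _ _ => by positivity)
  rcases (Real.sqrt_nonneg (∑ n ∈ s, ‖c n‖ ^ 2)).eq_or_lt with h0 | hpos
  · have hz : ∑ n ∈ s, ‖c n‖ ^ 2 = 0 := by rw [← hσ2, hσ, ← h0]; simp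
    rw [Finset.sum_eq_zero_iff_of_nonneg fun _ _ => by positivity] at hz
    have : ∀ ω, ∑ n ∈ s, c n * X n ω = 0 := fun ω => Finset.sum_eq_zero fun n hn => by
      have := hz n hn
      simp at this
      simp [this]
    simp only [this, norm_zero]
    rw [hσ, ← h0]
    simp
    positivity
  have hone : ∀ u : ℂ, ‖u‖ = 1 → P.real {ω | t * σ ≤ (u * ∑ n ∈ s, c n * X n ω).re} ≤
      Real.exp (-t ^ 2 / (2 * κ)) := by
    intro u hu
    have hind : iIndepFun (fun n ω => (u * c n * X n ω).re) P :=
      hXi.comp (fun n x => (u * c n * x).re) fun n =>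
        Complex.measurable_re.comp (measurable_const_mul _)
    have h := HasSubgaussianMGF.measure_sum_ge_le_of_iIndepFun hind (s := s)
      (fun n _ => hsub n (u * c n)) (ε := t * σ) (by positivity)
    have hre : ∀ ω, (u * ∑ n ∈ s, c n * X n ω).re = ∑ n ∈ s, (u * c n * X n ω).re := fun ω => by
      rw [Finset.mul_sum, Complex.re_sum]
      simp only [mul_assoc]
    simp only [hre]
    refine h.trans (le_of_eq ?_)
    have hs : ((∑ n ∈ s, Real.toNNReal (κ * ‖u * c n‖ ^ 2) : NNReal) : ℝ) = κ * σ ^ 2 := by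
      rw [NNReal.coe_sum, hσ2, Finset.mul_sum]
      refine Finset.sum_congr rfl fun n _ => ?_
      rw [Real.coe_toNNReal _ (by positivity), norm_mul, hu, one_mul]
    have hσ0 : σ ≠ 0 := ne_of_gt hpos
    congr 1
    rw [hs]
    field_simp
  calc P.real {ω | 2 * t * σ < ‖∑ n ∈ s, c n * X n ω‖}
      ≤ P.real ({ω | t * σ ≤ ((1 : ℂ) * ∑ n ∈ s, c n * X n ω).re} ∪
          ({ω | t * σ ≤ ((-1 : ℂ) * ∑ n ∈ s, c n * X n ω).re} ∪
          ({ω | t * σ ≤ (Complex.I * ∑ n ∈ s, c n * X n ω).re} ∪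
            {ω | t * σ ≤ (-Complex.I * ∑ n ∈ s, c n * X n ω).re}))) := by
        refine measureReal_mono fun ω hω => ?_
        have hω' : 2 * (t * σ) ≤ ‖∑ n ∈ s, c n * X n ω‖ := by
          rw [← mul_assoc]; exact le_of_lt hω
        exact exists_rotation_re_ge hω'
    _ ≤ Real.exp (-t ^ 2 / (2 * κ)) + (Real.exp (-t ^ 2 / (2 * κ)) +
          (Real.exp (-t ^ 2 / (2 * κ)) + Real.exp (-t ^ 2 / (2 * κ)))) := by
        refine (measureReal_union_le _ _).trans (add_le_add (hone _ (by simp)) ?_)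
        refine (measureReal_union_le _ _).trans (add_le_add (hone _ (by simp)) ?_)
        exact (measureReal_union_le _ _).trans (add_le_add (hone _ (by simp)) (hone _ (by simp)))
    _ = _ := by ring

end Subgaussian

/-! ### Discretization: passing from lattice points to arbitrary points. -/

lemma norm_one_add_pow_sub_one_le (η : ℂ) (n : ℕ) : ‖(1 + η) ^ n - 1‖ ≤ (1 + ‖η‖) ^ n - 1 := by
  induction n with
  | zero => simp
  | succ n ih =>
    have h1 : (1 + η) ^ (n + 1) - 1 = (1 + η) * ((1 + η) ^ n - 1) + η := by ring
    have h2 : ‖1 + η‖ ≤ 1 + ‖η‖ := by simpa using norm_add_le (1 : ℂ) η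
    calc ‖(1 + η) ^ (n + 1) - 1‖ ≤ ‖1 + η‖ * ‖(1 + η) ^ n - 1‖ + ‖η‖ := by
          rw [h1, ← norm_mul]; exact norm_add_le _ _
      _ ≤ (1 + ‖η‖) * ((1 + ‖η‖) ^ n - 1) + ‖η‖ := by gcongr
      _ = _ := by ring

lemma norm_one_add_pow_sub_one_le_two_mul {η : ℂ} {n : ℕ} (h : n * ‖η‖ ≤ 1) :
    ‖(1 + η) ^ n - 1‖ ≤ 2 * (n * ‖η‖) := by
  have h1 : (1 + ‖η‖) ^ n ≤ Real.exp (n * ‖η‖) := by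
    rw [Real.exp_nat_mul]
    gcongr
    linarith [Real.add_one_le_exp ‖η‖]
  have h0 : 0 ≤ n * ‖η‖ := by positivity
  have h2 := Real.abs_exp_sub_one_le (x := n * ‖η‖) (by rwa [abs_of_nonneg h0])
  rw [abs_of_nonneg h0] at h2
  linarith [norm_one_add_pow_sub_one_le η n, le_abs_self (Real.exp (n * ‖η‖) - 1)]

/-- Comparison of a random polynomial at the points `z` and `z * (1 + η)`. -/
lemma norm_sum_le_of_perturbation {N : ℕ} {b x : ℕ → ℂ} {η : ℂ} {D : ℝ} (hD : 0 ≤ D)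
    (hη : ‖η‖ ≤ 4 / (N + 1 : ℝ) ^ 4) (hx : ∀ n < N, ‖x n‖ ≤ N)
    (h : ‖∑ n ∈ Finset.range N, b n * (1 + η) ^ n * x n‖ ≤
      D * Real.sqrt (∑ n ∈ Finset.range N, ‖b n * (1 + η) ^ n‖ ^ 2)) :
    ‖∑ n ∈ Finset.range N, b n * x n‖ ≤
      (3 * D + 8) * Real.sqrt (∑ n ∈ Finset.range N, ‖b n‖ ^ 2) := by
  set T := Real.sqrt (∑ n ∈ Finset.range N, ‖b n‖ ^ 2) with hT
  have hT0 : 0 ≤ T := Real.sqrt_nonneg _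
  have hbT : ∀ n ∈ Finset.range N, ‖b n‖ ≤ T := fun n hn => Real.le_sqrt_of_sq_le
    (Finset.single_le_sum (f := fun n => ‖b n‖ ^ 2) (fun _ _ => by positivity) hn)
  have hnη : ∀ n ∈ Finset.range N, n * ‖η‖ ≤ N * (4 / (N + 1 : ℝ) ^ 4) := fun n hn => by
    have : (n : ℝ) ≤ N := by exact_mod_cast (Finset.mem_range.1 hn).le
    gcongr
  have hN0 : (0 : ℝ) ≤ N := Nat.cast_nonneg N
  have hsmall : N * (4 / (N + 1 : ℝ) ^ 4) ≤ 1 := by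
    rw [← mul_div_assoc, div_le_one (by positivity)]
    nlinarith [sq_nonneg ((N : ℝ) ^ 2), pow_nonneg hN0 3, pow_nonneg hN0 2]
  have hpow : ∀ n ∈ Finset.range N, ‖(1 + η) ^ n - 1‖ ≤ 2 * (N * (4 / (N + 1 : ℝ) ^ 4)) := fun n hn =>
    (norm_one_add_pow_sub_one_le_two_mul ((hnη n hn).trans hsmall)).trans
      (by linarith [hnη n hn])
  have hpow3 : ∀ n ∈ Finset.range N, ‖(1 + η) ^ n‖ ≤ 3 := fun n hn => by
    have h1 : ‖(1 + η) ^ n‖ ≤ ‖(1 + η) ^ n - 1‖ + 1 := by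
      simpa using norm_add_le ((1 + η) ^ n - 1) 1
    linarith [hpow n hn]
  have hTw : Real.sqrt (∑ n ∈ Finset.range N, ‖b n * (1 + η) ^ n‖ ^ 2) ≤ 3 * T := by
    have : (3 : ℝ) * T = Real.sqrt (∑ n ∈ Finset.range N, (3 * ‖b n‖) ^ 2) := by
      simp only [mul_pow]
      rw [← Finset.mul_sum, Real.sqrt_mul (by positivity), Real.sqrt_sq (by norm_num)]
    rw [this]
    refine Real.sqrt_le_sqrt (Finset.sum_le_sum fun n hn => ?_)
    rw [norm_mul, mul_comm]
    gcongr
    exact hpow3 n hn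
  have hsplit : ∑ n ∈ Finset.range N, b n * x n =
      ∑ n ∈ Finset.range N, b n * (1 + η) ^ n * x n -
        ∑ n ∈ Finset.range N, b n * ((1 + η) ^ n - 1) * x n := by
    rw [← Finset.sum_sub_distrib]
    exact Finset.sum_congr rfl fun n _ => by ring
  -- Each of the `N` summands is at most `T · 8N/(N+1)⁴ · N`; the mesh beats the resulting `N³`.
  have hdiff : ‖∑ n ∈ Finset.range N, b n * ((1 + η) ^ n - 1) * x n‖ ≤ 8 * T := by
    calc ‖∑ n ∈ Finset.range N, b n * ((1 + η) ^ n - 1) * x n‖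
        ≤ ∑ n ∈ Finset.range N, T * (2 * (N * (4 / (N + 1 : ℝ) ^ 4))) * N := by
          refine norm_sum_le_of_le _ fun n hn => ?_
          rw [norm_mul, norm_mul]
          gcongr
          · exact hbT n hn
          · exact hpow n hn
          · exact hx n (Finset.mem_range.1 hn)
      _ = 8 * N ^ 3 / (N + 1 : ℝ) ^ 4 * T := by
          rw [Finset.sum_const, Finset.card_range, nsmul_eq_mul]
          ring
      _ ≤ 8 * T := by
          gcongr
          rw [div_le_iff₀ (by positivity)]
          nlinarith [sq_nonneg ((N : ℝ) ^ 2), pow_nonneg hN0 3, pow_nonneg hN0 2]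
  rw [hsplit]
  calc _ ≤ D * (3 * T) + 8 * T :=
        (norm_sub_le _ _).trans (add_le_add (h.trans (mul_le_mul_of_nonneg_left hTw hD)) hdiff)
    _ = _ := by ring

/-- The lattice point `(j + k i) / M`. -/
noncomputable def latticePoint (M : ℕ) (p : ℤ × ℤ) : ℂ := (p.1 + p.2 * Complex.I) / M

/-- Rounding both coordinates down moves `z` by at most `2/M`, and `|z| ≥ 1/2` makes this a relative
error `4/M`. The lattice point may leave the unit disk, which is harmless for polynomials. -/
lemma exists_latticePoint {M : ℕ} (hM : 0 < M) {z : ℂ} (hz : 1 / 2 ≤ ‖z‖) (hz1 : ‖z‖ < 1) :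
    ∃ p ∈ Finset.Icc (-(M : ℤ)) M ×ˢ Finset.Icc (-(M : ℤ)) M, ∃ η : ℂ, ‖η‖ ≤ 4 / (M : ℝ) ∧
      latticePoint M p = z * (1 + η) := by
  have hM' : (0 : ℝ) < M := by exact_mod_cast hM
  have hz0 : z ≠ 0 := fun h => by simp [h] at hz; linarith
  have hfloor : ∀ x : ℝ, |x| ≤ 1 → ⌊M * x⌋ ∈ Finset.Icc (-(M : ℤ)) M := fun x hx => by
    obtain ⟨h1, h2⟩ := abs_le.1 hx
    rw [Finset.mem_Icc]
    constructor
    · rw [Int.le_floor]; push_cast; nlinarith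
    · have : (⌊M * x⌋ : ℝ) ≤ M := (Int.floor_le _).trans (by nlinarith)
      exact_mod_cast this
  refine ⟨(⌊M * z.re⌋, ⌊M * z.im⌋), Finset.mk_mem_product
    (hfloor _ ((Complex.abs_re_le_norm z).trans hz1.le))
    (hfloor _ ((Complex.abs_im_le_norm z).trans hz1.le)),
    (latticePoint M (⌊M * z.re⌋, ⌊M * z.im⌋) - z) / z, ?_, by field_simp; ring⟩
  set w := latticePoint M (⌊M * z.re⌋, ⌊M * z.im⌋) with hw
  have hwz : ‖(M : ℂ) * (w - z)‖ ≤ 2 := by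
    have h : (M : ℂ) * (w - z) = (⌊M * z.re⌋ - M * z.re : ℝ) + (⌊M * z.im⌋ - M * z.im : ℝ) * Complex.I := by
      have hMc : (M : ℂ) ≠ 0 := by exact_mod_cast hM.ne'
      have : (M : ℂ) * w = ⌊M * z.re⌋ + ⌊M * z.im⌋ * Complex.I := by
        rw [hw, latticePoint]; field_simp
      rw [mul_sub, this]
      nth_rewrite 3 [← Complex.re_add_im z]
      push_cast
      ring
    rw [h]
    refine (norm_add_le _ _).trans ?_
    rw [norm_mul, Complex.norm_I, mul_one, Complex.norm_real, Complex.norm_real, Real.norm_eq_abs,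
      Real.norm_eq_abs, abs_sub_comm, abs_sub_comm (⌊M * z.im⌋ : ℝ), Int.self_sub_floor,
      Int.self_sub_floor, abs_of_nonneg (Int.fract_nonneg _), abs_of_nonneg (Int.fract_nonneg _)]
    linarith [Int.fract_lt_one (M * z.re), Int.fract_lt_one (M * z.im)]
  rw [norm_mul, Complex.norm_natCast] at hwz
  rw [norm_div, div_le_div_iff₀ (by linarith) hM']
  nlinarith

/-! ### Almost sure bounds by Borel–Cantelli. -/

section Random

variable {Ω : Type*} [MeasurableSpace Ω] {P : Measure Ω}

lemma ae_eventually_norm_le [IsProbabilityMeasure P] {X : ℕ → Ω → ℂ} (hXs : SubgaussianSeq X P) :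
    ∀ᵐ ω ∂P, ∀ᶠ n : ℕ in Filter.atTop, ‖X n ω‖ ≤ n := by
  obtain ⟨K, τ, hK, hτ, htail⟩ := hXs
  have hsum : Summable fun n : ℕ => K * Real.exp (n * (-1 / τ ^ 2)) :=
    (Real.summable_exp_nat_mul_iff.2 (div_neg_of_neg_of_pos (by norm_num) (by positivity))).mul_left K
  have hle : ∀ n : ℕ, P {ω | (n : ℝ) < ‖X n ω‖} ≤
      ENNReal.ofReal (K * Real.exp (n * (-1 / τ ^ 2))) := fun n => by
    rw [← ofReal_measureReal]
    refine ENNReal.ofReal_le_ofReal ((htail n n (Nat.cast_nonneg n)).trans ?_)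
    have h1 : (n : ℝ) ≤ (n : ℝ) ^ 2 := by exact_mod_cast Nat.le_self_pow two_ne_zero n
    have h2 : -(n : ℝ) ^ 2 / τ ^ 2 ≤ n * (-1 / τ ^ 2) := by
      rw [← mul_div_assoc]
      gcongr
      linarith
    gcongr
  have hne : ∑' n : ℕ, P {ω | (n : ℝ) < ‖X n ω‖} ≠ ⊤ :=
    ((ENNReal.tsum_le_tsum hle).trans_lt hsum.tsum_ofReal_lt_top).ne
  filter_upwards [ae_eventually_notMem hne] with ω hω
  filter_upwards [hω] with n hn
  exact not_lt.1 hn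

lemma eventually_forall_lt_norm_le {x : ℕ → ℂ} (hx : ∀ᶠ n : ℕ in Filter.atTop, ‖x n‖ ≤ n) :
    ∀ᶠ N : ℕ in Filter.atTop, ∀ n < N, ‖x n‖ ≤ N := by
  obtain ⟨n₀, hn₀⟩ := Filter.eventually_atTop.1 hx
  obtain ⟨B, hB⟩ := ((Finset.range n₀).image fun n => ‖x n‖).bddAbove
  filter_upwards [Filter.eventually_ge_atTop ⌈B⌉₊] with N hN n hn
  rcases lt_or_ge n n₀ with h | h
  · exact (hB (by simpa using ⟨n, h, rfl⟩)).trans ((Nat.le_ceil B).trans (by exact_mod_cast hN))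
  · exact (hn₀ n h).trans (by exact_mod_cast hn.le)

/-- Almost surely, the partial sums of a random power series are controlled by their quadratic means
at all points of a lattice of polynomially growing size. -/
lemma ae_eventually_norm_sum_latticePoint_le [IsProbabilityMeasure P] (a : ℕ → ℂ)
    {X : ℕ → Ω → ℂ} (hXm : ∀ n, Measurable (X n)) (hXi : iIndepFun X P)
    (hXc : CentredSeq X P) (hXs : SubgaussianSeq X P) :
    ∃ C : ℝ, 0 < C ∧ ∀ᵐ ω ∂P, ∀ᶠ N : ℕ in Filter.atTop,
      ∀ p ∈ Finset.Icc (-(((N + 1) ^ 4 : ℕ) : ℤ)) ((N + 1) ^ 4 : ℕ) ×ˢ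
          Finset.Icc (-(((N + 1) ^ 4 : ℕ) : ℤ)) ((N + 1) ^ 4 : ℕ),
        ‖∑ n ∈ Finset.range N, a n * latticePoint ((N + 1) ^ 4) p ^ n * X n ω‖ ≤
          C * Real.sqrt (Real.log (N + 1)) *
            Real.sqrt (∑ n ∈ Finset.range N, ‖a n * latticePoint ((N + 1) ^ 4) p ^ n‖ ^ 2) := by
  obtain ⟨κ, hκ, hdev⟩ := exists_measureReal_norm_sum_le hXm hXi hXc hXs
  -- The deviation parameter `√(20κ log(N+1))` gives probability `4(N+1)^{-10}` per point; with at
  -- most `9(N+1)^8` points the union bound is summable in `N`.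
  refine ⟨2 * Real.sqrt (20 * κ), by positivity, ?_⟩
  set G : ℕ → Finset (ℤ × ℤ) := fun N => Finset.Icc (-(((N + 1) ^ 4 : ℕ) : ℤ)) ((N + 1) ^ 4 : ℕ) ×ˢ
          Finset.Icc (-(((N + 1) ^ 4 : ℕ) : ℤ)) ((N + 1) ^ 4 : ℕ) with hG
  set B : ℕ → ℤ × ℤ → Set Ω := fun N p => {ω |
    2 * (Real.sqrt (20 * κ) * Real.sqrt (Real.log (N + 1))) *
      Real.sqrt (∑ n ∈ Finset.range N, ‖a n * latticePoint ((N + 1) ^ 4) p ^ n‖ ^ 2) <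
    ‖∑ n ∈ Finset.range N, a n * latticePoint ((N + 1) ^ 4) p ^ n * X n ω‖} with hB
  have hBle : ∀ N p, P.real (B N p) ≤ 4 / ((N : ℝ) + 1) ^ 10 := fun N p => by
    refine (hdev _ _ _ (by positivity)).trans (le_of_eq ?_)
    have hlog : 0 ≤ Real.log ((N : ℝ) + 1) := Real.log_nonneg (by
      linarith [Nat.cast_nonneg (α := ℝ) N])
    rw [mul_pow, Real.sq_sqrt (by positivity), Real.sq_sqrt hlog]
    have : -(20 * κ * Real.log ((N : ℝ) + 1)) / (2 * κ) = -((10 : ℕ) * Real.log ((N : ℝ) + 1)) := by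
      push_cast
      field_simp
      ring
    rw [this, Real.exp_neg, Real.exp_nat_mul, Real.exp_log (by positivity), ← div_eq_mul_inv]
  have hcard : ∀ N, ((G N).card : ℝ) ≤ 9 * ((N : ℝ) + 1) ^ 8 := fun N => by
    have h1 : (G N).card = (2 * (N + 1) ^ 4 + 1) ^ 2 := by
      rw [hG, Finset.card_product, Int.card_Icc, sq]
      congr 1 <;> omega
    rw [h1]
    push_cast
    have : (1 : ℝ) ≤ ((N : ℝ) + 1) ^ 4 := one_le_pow₀ (by linarith [Nat.cast_nonneg (α := ℝ) N])
    nlinarith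
  have hU : ∀ N, P (⋃ p ∈ G N, B N p) ≤ ENNReal.ofReal (36 * (1 / ((N : ℝ) + 1) ^ 2)) := fun N => by
    rw [← ofReal_measureReal (measure_ne_top P _)]
    refine ENNReal.ofReal_le_ofReal ((measureReal_biUnion_finset_le _ _).trans ?_)
    calc ∑ p ∈ G N, P.real (B N p) ≤ ∑ p ∈ G N, 4 / ((N : ℝ) + 1) ^ 10 :=
          Finset.sum_le_sum fun p _ => hBle N p
      _ = (G N).card * (4 / ((N : ℝ) + 1) ^ 10) := by rw [Finset.sum_const, nsmul_eq_mul]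
      _ ≤ 9 * ((N : ℝ) + 1) ^ 8 * (4 / ((N : ℝ) + 1) ^ 10) := by
          gcongr
          exact hcard N
      _ = _ := by field_simp; norm_num
  have hsum : Summable fun N : ℕ => 36 * (1 / ((N : ℝ) + 1) ^ 2) := by
    have := (summable_nat_add_iff 1).2 (Real.summable_one_div_nat_pow.2 (one_lt_two))
    push_cast at this
    exact this.mul_left 36
  have hne : ∑' N : ℕ, P (⋃ p ∈ G N, B N p) ≠ ⊤ :=
    ((ENNReal.tsum_le_tsum hU).trans_lt hsum.tsum_ofReal_lt_top).ne
  filter_upwards [ae_eventually_notMem hne] with ω hω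
  filter_upwards [hω] with N hN p hp
  simp only [mem_iUnion, not_exists] at hN
  have := hN p hp
  simp only [hB, mem_ofPred_eq, not_lt] at this
  rwa [← mul_assoc 2] at this

/-- Almost surely, all partial sums of large order of a random power series are bounded by
`C √(log (N + 1))` times their quadratic means, uniformly in an annulus. -/
lemma ae_eventually_norm_sum_le [IsProbabilityMeasure P] (a : ℕ → ℂ)
    {X : ℕ → Ω → ℂ} (hXm : ∀ n, Measurable (X n)) (hXi : iIndepFun X P)
    (hXc : CentredSeq X P) (hXs : SubgaussianSeq X P) :
    ∃ C : ℝ, 0 < C ∧ ∀ᵐ ω ∂P, ∀ᶠ N : ℕ in Filter.atTop, ∀ z : ℂ, 1 / 2 ≤ ‖z‖ → ‖z‖ < 1 →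
      ‖∑ n ∈ Finset.range N, a n * X n ω * z ^ n‖ ≤
        C * Real.sqrt (Real.log (N + 1)) *
          Real.sqrt (∑ n ∈ Finset.range N, ‖a n * z ^ n‖ ^ 2) := by
  obtain ⟨C, hC, hae⟩ := ae_eventually_norm_sum_latticePoint_le a hXm hXi hXc hXs
  refine ⟨3 * C + 8, by positivity, ?_⟩
  filter_upwards [hae, ae_eventually_norm_le hXs] with ω hω hX
  filter_upwards [hω, eventually_forall_lt_norm_le hX, Filter.eventually_ge_atTop 2]
    with N hN hXN hN2 z hz hz1
  obtain ⟨p, hp, η, hη, hpη⟩ := exists_latticePoint (M := (N + 1) ^ 4) (by positivity) hz hz1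
  have h := hN p hp
  simp only [hpη, mul_pow, ← mul_assoc] at h
  push_cast at hη
  have h' := norm_sum_le_of_perturbation (b := fun n => a n * z ^ n) (by positivity) hη hXN h
  have hre : ∑ n ∈ Finset.range N, a n * X n ω * z ^ n =
      ∑ n ∈ Finset.range N, a n * z ^ n * X n ω := Finset.sum_congr rfl fun n _ => by ring
  rw [hre]
  refine h'.trans (mul_le_mul_of_nonneg_right ?_ (Real.sqrt_nonneg _))
  -- This lets the additive `8` from the perturbation be absorbed into the logarithmic factor.
  have h1 : 1 ≤ Real.sqrt (Real.log (N + 1)) := by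
    rw [Real.one_le_sqrt, Real.le_log_iff_exp_le (by positivity)]
    have : (2 : ℝ) ≤ N := by exact_mod_cast hN2
    linarith [Real.exp_one_lt_d9]
  nlinarith

end Random

/-! ### The exceptional set. -/

/-- In the variable `1 - r` the interval is a multiplicative neighbourhood of `1 - s`, so its
logarithmic measure depends on `A` alone; length times maximal density suffices. -/
lemma setLIntegral_inv_one_sub_le {s A : ℝ} (hs : s < 1) (hA : 1 ≤ A) :
    ∫⁻ r in Ioo (1 - (1 - s) * A) (1 - (1 - s) / A), ENNReal.ofReal (1 / (1 - r)) ≤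
      ENNReal.ofReal (A ^ 2 - 1) := by
  have hs' : 0 < 1 - s := by linarith
  have hA0 : 0 < A := by linarith
  calc _ ≤ ∫⁻ r in Ioo (1 - (1 - s) * A) (1 - (1 - s) / A), ENNReal.ofReal (A / (1 - s)) := by
        refine setLIntegral_mono' measurableSet_Ioo fun r hr => ENNReal.ofReal_le_ofReal ?_
        have h1 : (1 - s) / A ≤ 1 - r := by linarith [hr.2]
        rw [show A / (1 - s) = 1 / ((1 - s) / A) by field_simp]
        exact one_div_le_one_div_of_le (by positivity) h1
    _ = ENNReal.ofReal (A / (1 - s)) * ENNReal.ofReal ((1 - s) * A - (1 - s) / A) := by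
        rw [setLIntegral_const, Real.volume_Ioo]
        congr 2
        ring
    _ = _ := by
        rw [← ENNReal.ofReal_mul (by positivity)]
        congr 1
        field_simp

/-- A growth lemma of Borel type: a nondecreasing unbounded function `g` on `[R, 1)` at most
quadruples on passing from `r` to a point at distance `(1 - r) / (2 g(r))`, outside an open set of
finite logarithmic measure. -/
lemma exists_growth_exceptional_set {g : ℝ → ℝ} {R : ℝ} (hR : 0 < R)
    (hg : MonotoneOn g (Ico R 1)) (hlim : ∀ M : ℝ, ∃ r ∈ Ico R 1, M ≤ g r) :
    ∃ E : Set ℝ, IsOpen E ∧ E ⊆ Ico (0 : ℝ) 1 ∧ FiniteLogMeasure E ∧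
      ∀ r ∈ Ico R 1, r ∉ E → 1 ≤ g r → g (1 - (1 - r) * (1 - 1 / (2 * g r))) ≤ 4 * g r := by
  -- `s k` is where `g` crosses `2^(k+2)`, or `0` if the set is empty. If `2^k ≤ g r < 2^(k+1)` and
  -- the conclusion fails at `r`, the crossing lies between `r` and the shifted point, so `1 - r`
  -- and `1 - s k` differ by a factor less than `A k`. The excess of `A k` over `1` is geometric,
  -- hence summable.
  set s : ℕ → ℝ := fun k => sSup {r | r ∈ Ico R 1 ∧ g r < 2 ^ (k + 2)} with hs
  set A : ℕ → ℝ := fun k => 1 + 4 * (1 / 2) ^ k with hA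
  have hx0 : ∀ k : ℕ, (0 : ℝ) < (1 / 2) ^ k := fun k => by positivity
  have hx1 : ∀ k : ℕ, ((1 : ℝ) / 2) ^ k ≤ 1 := fun k => pow_le_one₀ (by norm_num) (by norm_num)
  have hs1 : ∀ k, s k < 1 := fun k => by
    obtain ⟨r, hr, hgr⟩ := hlim (2 ^ (k + 2))
    refine lt_of_le_of_lt (Real.sSup_le (fun q hq => ?_) (hR.le.trans hr.1)) hr.2
    by_contra! h
    exact absurd (hg hr hq.1 h.le) (by linarith [hq.2])
  refine ⟨⋃ k, Ioo (1 - (1 - s k) * A k) (1 - (1 - s k) / A k) ∩ Ioo 0 1,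
    isOpen_iUnion fun k => isOpen_Ioo.inter isOpen_Ioo,
    iUnion_subset fun k => inter_subset_right.trans Ioo_subset_Ico_self, ?_, ?_⟩
  · have hsum : Summable fun k : ℕ => 24 * ((1 : ℝ) / 2) ^ k :=
      (summable_geometric_of_lt_one (by norm_num) (by norm_num)).mul_left 24
    refine lt_of_le_of_lt ((lintegral_iUnion_le _ _).trans (ENNReal.tsum_le_tsum fun k => ?_))
      hsum.tsum_ofReal_lt_top
    refine (lintegral_mono_set inter_subset_left).trans
      ((setLIntegral_inv_one_sub_le (hs1 k) (by simp only [hA]; linarith [hx0 k])).trans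
        (ENNReal.ofReal_le_ofReal ?_))
    simp only [hA]
    nlinarith [hx0 k, hx1 k]
  · intro r hr hrE h1
    by_contra! hcon
    obtain ⟨k, hk, hk1⟩ := exists_nat_pow_near h1 (one_lt_two : (1 : ℝ) < 2)
    have hg0 : 0 < g r := by linarith
    have hr1 : 0 < 1 - r := by linarith [hr.2]
    have hinv : 1 / (2 * g r) ≤ (1 / 2) ^ k / 2 := by
      rw [one_div_pow, div_div, mul_comm]
      exact one_div_le_one_div_of_le (by positivity) (by linarith)
    have hinv0 : 0 < 1 / (2 * g r) := by positivity
    set ρ := 1 - (1 - r) * (1 - 1 / (2 * g r)) with hρ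
    have hρr : r ≤ ρ := by rw [hρ]; nlinarith
    have hρ1 : ρ < 1 := by
      have : 0 < (1 - r) * (1 - 1 / (2 * g r)) := mul_pos hr1 (by linarith [hx1 k])
      linarith
    have hρm : ρ ∈ Ico R 1 := ⟨hr.1.trans hρr, hρ1⟩
    have hrs : r ≤ s k := by
      refine le_csSup ⟨1, fun q hq => hq.1.2.le⟩ ⟨hr, hk1.trans ?_⟩
      exact pow_lt_pow_right₀ one_lt_two (by omega)
    have hsρ : s k ≤ ρ := by
      refine Real.sSup_le (fun q hq => ?_) (hR.le.trans hρm.1)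
      by_contra! h
      have h2 := hg hρm hq.1 h.le
      have h3 := hq.2
      rw [pow_add] at h3
      linarith
    have hA0 : 0 < A k := by simp only [hA]; linarith [hx0 k]
    have h1s : (1 - r) * (1 - (1 / 2) ^ k / 2) ≤ 1 - s k := by
      have : (1 - r) * (1 - (1 / 2) ^ k / 2) ≤ (1 - r) * (1 - 1 / (2 * g r)) := by gcongr
      linarith
    refine hrE (mem_iUnion.2 ⟨k, ⟨?_, ?_⟩, lt_of_lt_of_le hR hr.1, hr.2⟩)
    · have h2 : (1 - r) * (1 - (1 / 2) ^ k / 2) * A k ≤ (1 - s k) * A k := by gcongr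
      have h3 : 1 < (1 - (1 / 2) ^ k / 2) * A k := by
        simp only [hA]
        nlinarith [hx0 k, hx1 k]
      nlinarith
    · have h2 : (1 - s k) / A k < 1 - r := by
        rw [div_lt_iff₀ hA0]
        have : 0 < (1 - r) * (4 * (1 / 2) ^ k) := by positivity
        simp only [hA]
        linarith
      linarith

/-! ### Power series, maximum term and decay of the terms of large order. -/

section Deterministic

variable {a : ℕ → ℂ}

/-- If the sum of `∑ |b_n| ρ^n` is finite for all `ρ < 1`, the power series defines an analytic
function in the unit disk. -/
lemma analyticOnNhd_tsum {b : ℕ → ℂ}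
    (h : ∀ ρ ∈ Ico (0 : ℝ) 1, Summable fun n => ‖b n‖ * ρ ^ n) :
    (∀ z ∈ ball (0 : ℂ) 1, Summable fun n => b n * z ^ n) ∧
      AnalyticOnNhd ℂ (fun z => ∑' n, b n * z ^ n) (ball (0 : ℂ) 1) := by
  constructor
  · intro z hz
    refine Summable.of_norm ?_
    simpa [norm_mul, norm_pow] using h ‖z‖ ⟨norm_nonneg _, by simpa using hz⟩
  · refine DifferentiableOn.analyticOnNhd (fun z hz => ?_) isOpen_ball
    obtain ⟨ρ, hzρ, hρ1⟩ := exists_between (show ‖z‖ < 1 by simpa using hz)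
    have hd := Complex.differentiableOn_tsum_of_summable_norm (U := ball (0 : ℂ) ρ)
      (F := fun n z => b n * z ^ n) (h ρ ⟨(norm_nonneg z).trans hzρ.le, hρ1⟩)
      (fun n => by fun_prop) isOpen_ball (fun n w hw => by
        rw [norm_mul, norm_pow]
        have : ‖w‖ ≤ ρ := by simpa using (mem_ball.1 hw).le
        gcongr)
    exact (hd.differentiableAt (isOpen_ball.mem_nhds (by simpa using hzρ))).differentiableWithinAt

lemma summable_norm_mul_nat_mul_pow (ha : ∀ r ∈ Ico (0 : ℝ) 1, Summable fun n => ‖a n‖ * r ^ n)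
    {r : ℝ} (hr : r ∈ Ico (0 : ℝ) 1) : Summable fun n : ℕ => ‖a n‖ * n * r ^ n := by
  obtain ⟨ρ, hrρ, hρ1⟩ := exists_between hr.2
  have hρ0 : 0 < ρ := hr.1.trans_lt hrρ
  have hsum := ha ρ ⟨hρ0.le, hρ1⟩
  have hq : ‖r / ρ‖ < 1 := by
    rw [Real.norm_of_nonneg (div_nonneg hr.1 hρ0.le), div_lt_one hρ0]; exact hrρ
  have hg := summable_pow_mul_geometric_of_norm_lt_one 1 hq
  have hr0 := hr.1
  refine Summable.of_nonneg_of_le (fun n => by positivity) (fun n => ?_)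
    (hg.mul_left (∑' n, ‖a n‖ * ρ ^ n))
  have h1 : ‖a n‖ * ρ ^ n ≤ ∑' n, ‖a n‖ * ρ ^ n := hsum.le_tsum n fun _ _ => by positivity
  have h2 : ‖a n‖ * n * r ^ n = ‖a n‖ * ρ ^ n * ((n : ℝ) ^ 1 * (r / ρ) ^ n) := by
    rw [div_pow]; field_simp
  rw [h2]
  gcongr

lemma summable_norm_sq_mul_pow (ha : ∀ r ∈ Ico (0 : ℝ) 1, Summable fun n => ‖a n‖ * r ^ n)
    {r : ℝ} (hr : r ∈ Ico (0 : ℝ) 1) : Summable fun n : ℕ => ‖a n‖ ^ 2 * r ^ (2 * n) := by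
  have hsum := ha r hr
  have hr0 := hr.1
  refine Summable.of_nonneg_of_le (fun n => by positivity) (fun n => ?_)
    (hsum.mul_left (∑' n, ‖a n‖ * r ^ n))
  have h1 : ‖a n‖ * r ^ n ≤ ∑' n, ‖a n‖ * r ^ n := hsum.le_tsum n fun _ _ => by positivity
  have h2 : ‖a n‖ ^ 2 * r ^ (2 * n) = ‖a n‖ * r ^ n * (‖a n‖ * r ^ n) := by ring
  rw [h2]
  gcongr

lemma norm_mul_pow_le_maxTerm (ha : ∀ r ∈ Ico (0 : ℝ) 1, Summable fun n => ‖a n‖ * r ^ n)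
    {r : ℝ} (hr : r ∈ Ico (0 : ℝ) 1) (n : ℕ) : ‖a n‖ * r ^ n ≤ maxTerm a r := by
  have hr0 := hr.1
  refine le_ciSup (f := fun n => ‖a n‖ * r ^ n) ⟨∑' n, ‖a n‖ * r ^ n, ?_⟩ n
  rintro _ ⟨m, rfl⟩
  exact (ha r hr).le_tsum m fun _ _ => by positivity

lemma maxTerm_mono (ha : ∀ r ∈ Ico (0 : ℝ) 1, Summable fun n => ‖a n‖ * r ^ n) {r ρ : ℝ}
    (hr : 0 ≤ r) (hrρ : r ≤ ρ) (hρ : ρ < 1) : maxTerm a r ≤ maxTerm a ρ :=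
  ciSup_le fun n => le_trans (by gcongr) (norm_mul_pow_le_maxTerm ha ⟨hr.trans hrρ, hρ⟩ n)

lemma maxTerm_pos (ha : ∀ r ∈ Ico (0 : ℝ) 1, Summable fun n => ‖a n‖ * r ^ n)
    (hne : ∃ m, a m ≠ 0) {r : ℝ} (hr : r ∈ Ioo (0 : ℝ) 1) : 0 < maxTerm a r := by
  obtain ⟨m, hm⟩ := hne
  exact (mul_pos (norm_pos_iff.2 hm) (pow_pos hr.1 m)).trans_le
    (norm_mul_pow_le_maxTerm ha ⟨hr.1.le, hr.2⟩ m)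

lemma sqrt_sum_le_quadMean (ha : ∀ r ∈ Ico (0 : ℝ) 1, Summable fun n => ‖a n‖ * r ^ n)
    {r : ℝ} (hr : r ∈ Ico (0 : ℝ) 1) {z : ℂ} (hz : ‖z‖ = r) (s : Finset ℕ) :
    Real.sqrt (∑ n ∈ s, ‖a n * z ^ n‖ ^ 2) ≤ quadMean a r := by
  refine Real.sqrt_le_sqrt ?_
  have h : ∀ n, ‖a n * z ^ n‖ ^ 2 = ‖a n‖ ^ 2 * r ^ (2 * n) := fun n => by
    rw [norm_mul, norm_pow, hz]; ring
  simp only [h]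
  have hr0 := hr.1
  exact (summable_norm_sq_mul_pow ha hr).sum_le_tsum s fun _ _ => by positivity

lemma maxTerm_le_quadMean (ha : ∀ r ∈ Ico (0 : ℝ) 1, Summable fun n => ‖a n‖ * r ^ n)
    {r : ℝ} (hr : r ∈ Ico (0 : ℝ) 1) : maxTerm a r ≤ quadMean a r := by
  refine ciSup_le fun n => ?_
  have h := sqrt_sum_le_quadMean ha hr (z := r) (by simp [abs_of_nonneg hr.1]) {n}
  rw [Finset.sum_singleton, Real.sqrt_sq (norm_nonneg _), norm_mul, norm_pow, Complex.norm_real,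
    Real.norm_of_nonneg hr.1] at h
  exact h

lemma log_maxTerm_div_mono (ha : ∀ r ∈ Ico (0 : ℝ) 1, Summable fun n => ‖a n‖ * r ^ n)
    (hne : ∃ m, a m ≠ 0) :
    MonotoneOn (fun r => Real.log (maxTerm a r / (1 - r))) (Ico (1 / 2) 1) := by
  intro r hr ρ hρ hrρ
  have h1 : 0 < 1 - ρ := by linarith [hρ.2]
  have h2 : 0 < 1 - r := by linarith [hr.2]
  have h3 : 0 < maxTerm a r := maxTerm_pos ha hne ⟨by linarith [hr.1], hr.2⟩
  refine Real.log_le_log (by positivity) ?_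
  have := maxTerm_mono ha (by linarith [hr.1]) hrρ hρ.2
  have h4 : 0 ≤ maxTerm a ρ := h3.le.trans this
  gcongr

-- The maximum term itself may stay bounded; the divergence comes from `1/(1-r)`, as the maximum
-- term is at least its value at `1/2`.
open Filter Topology in
lemma tendsto_log_maxTerm_div (ha : ∀ r ∈ Ico (0 : ℝ) 1, Summable fun n => ‖a n‖ * r ^ n)
    (hne : ∃ m, a m ≠ 0) :
    Tendsto (fun r => Real.log (maxTerm a r / (1 - r))) (𝓝[<] 1) atTop := by
  have hδ : 0 < maxTerm a (1 / 2) := maxTerm_pos ha hne ⟨by norm_num, by norm_num⟩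
  have h0 : Tendsto (fun r : ℝ => 1 - r) (𝓝[<] 1) (𝓝[>] 0) := by
    refine tendsto_nhdsWithin_iff.2 ⟨?_, ?_⟩
    · have : Tendsto (fun r : ℝ => 1 - r) (𝓝 1) (𝓝 (1 - 1)) := by
        exact tendsto_const_nhds.sub tendsto_id
      rw [sub_self] at this
      exact this.mono_left nhdsWithin_le_nhds
    · filter_upwards [self_mem_nhdsWithin] with r hr
      have : r < 1 := hr
      exact sub_pos.2 this
  have h1 : Tendsto (fun r : ℝ => Real.log (maxTerm a (1 / 2) * (1 - r)⁻¹)) (𝓝[<] 1) atTop :=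
    Real.tendsto_log_atTop.comp
      (Tendsto.const_mul_atTop hδ (tendsto_inv_nhdsGT_zero.comp h0))
  refine tendsto_atTop_mono' _ ?_ h1
  filter_upwards [Ico_mem_nhdsLT (show (1 / 2 : ℝ) < 1 by norm_num)] with r hr
  have h2 : 0 < 1 - r := by linarith [hr.2]
  refine Real.log_le_log (by positivity) ?_
  rw [← div_eq_mul_inv]
  have := maxTerm_mono ha (by norm_num) hr.1 hr.2
  gcongr

/-- Wiman-Valiron type estimate: outside an open set of finite logarithmic measure, the terms of
large order are negligible. -/
lemma exists_exceptional_set_terms_le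
    (ha : ∀ r ∈ Ico (0 : ℝ) 1, Summable fun n => ‖a n‖ * r ^ n) (hne : ∃ m, a m ≠ 0) :
    ∃ E : Set ℝ, IsOpen E ∧ E ⊆ Ico (0 : ℝ) 1 ∧ FiniteLogMeasure E ∧
      ∀ r ∈ Ico (1 / 2 : ℝ) 1, r ∉ E → 1 ≤ Real.log (maxTerm a r / (1 - r)) → ∀ n : ℕ,
        16 * (1 / (1 - r) * Real.log (maxTerm a r / (1 - r))) ^ 2 ≤ n →
          ‖a n‖ * r ^ n ≤ Real.exp (-Real.sqrt n) := by
  obtain ⟨E, hEo, hE, hEm, hgrow⟩ := exists_growth_exceptional_set (by norm_num : (0 : ℝ) < 1 / 2)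
    (log_maxTerm_div_mono ha hne) (fun M => by
      obtain ⟨r, h1, h2⟩ := (((tendsto_log_maxTerm_div ha hne).eventually_ge_atTop M).and
        (Ico_mem_nhdsLT (show (1 / 2 : ℝ) < 1 by norm_num))).exists
      exact ⟨r, h2, h1⟩)
  refine ⟨E, hEo, hE, hEm, fun r hr hrE hT n hn => ?_⟩
  have hg := hgrow r hr hrE hT
  set T := Real.log (maxTerm a r / (1 - r)) with hTdef
  have hr1 : 0 < 1 - r := by linarith [hr.2]
  have hr0 : 0 < r := by linarith [hr.1]
  have hT0 : 0 < T := by linarith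
  set L := 1 / (1 - r) * T with hL
  have hTL : T ≤ L := by
    rw [hL]
    exact le_mul_of_one_le_left hT0.le (by rw [le_div_iff₀ hr1]; linarith)
  have hL0 : 0 < L := hT0.trans_le hTL
  -- The shifted point of the growth lemma: `ρ - r = 1/(2L)`, while `μ_f(ρ) ≤ e^{4T}`.
  set ρ := 1 - (1 - r) * (1 - 1 / (2 * T)) with hρ
  have hρr : ρ - r = 1 / (2 * L) := by rw [hρ, hL]; field_simp; ring
  have hinv : 1 / (2 * T) ≤ 1 / 2 := one_div_le_one_div_of_le (by norm_num) (by linarith)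
  have hρ1 : ρ < 1 := by
    have : 0 < (1 - r) * (1 - 1 / (2 * T)) := mul_pos hr1 (by linarith)
    linarith
  have hL2 : 0 < 1 / (2 * L) := by positivity
  have hρ0 : 0 < ρ := by linarith
  have hμ : maxTerm a ρ ≤ Real.exp (4 * T) := by
    have h1ρ : 0 < 1 - ρ := by linarith
    have h2 : 0 < maxTerm a ρ := maxTerm_pos ha hne ⟨hρ0, hρ1⟩
    rw [Real.log_le_iff_le_exp (by positivity), div_le_iff₀ h1ρ] at hg
    refine hg.trans (mul_le_of_le_one_right (by positivity) (by linarith))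
  have hquot : r ≤ ρ * Real.exp (-(ρ - r)) := by
    have := Real.add_one_le_exp (-(ρ - r))
    nlinarith
  -- The threshold `16L²` serves twice: `4T ≤ 4L ≤ √n`, and `n/(2L) ≥ 2√n`.
  have hsq : 4 * L ≤ Real.sqrt n := Real.le_sqrt_of_sq_le (by nlinarith)
  calc ‖a n‖ * r ^ n ≤ ‖a n‖ * (ρ * Real.exp (-(ρ - r))) ^ n := by gcongr
    _ = ‖a n‖ * ρ ^ n * Real.exp (n * -(ρ - r)) := by
        rw [mul_pow, ← Real.exp_nat_mul, mul_assoc]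
    _ ≤ Real.exp (4 * T) * Real.exp (n * -(ρ - r)) := by
        gcongr
        exact (norm_mul_pow_le_maxTerm ha ⟨hρ0.le, hρ1⟩ n).trans hμ
    _ = Real.exp (4 * T - n / (2 * L)) := by
        rw [← Real.exp_add, hρr]
        ring_nf
    _ ≤ Real.exp (-Real.sqrt n) := by
        rw [Real.exp_le_exp]
        have h1 : 2 * Real.sqrt n ≤ n / (2 * L) := by
          rw [le_div_iff₀ (by positivity)]
          nlinarith [Real.sq_sqrt (Nat.cast_nonneg (α := ℝ) n), Real.sqrt_nonneg (n : ℝ)]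
        linarith

/-! ### Truncation of the random series. -/

/-- The sixth Taylor term gives `e^{√n} ≥ n³/720`. -/
lemma summable_nat_mul_exp_neg_sqrt : Summable fun n : ℕ => (n : ℝ) * Real.exp (-Real.sqrt n) := by
  refine Summable.of_nonneg_of_le (fun n => by positivity) (fun n => ?_)
    ((Real.summable_one_div_nat_pow.2 one_lt_two).mul_left 720)
  rcases n.eq_zero_or_pos with rfl | hn
  · simp
  have hn' : (0 : ℝ) < n := by exact_mod_cast hn
  have h := Real.pow_div_factorial_le_exp _ (Real.sqrt_nonneg (n : ℝ)) 6
  have h6 : Real.sqrt n ^ 6 = (n : ℝ) ^ 3 := by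
    rw [show (6 : ℕ) = 2 * 3 from rfl, pow_mul, Real.sq_sqrt hn'.le]
  rw [h6, show ((Nat.factorial 6 : ℕ) : ℝ) = 720 by norm_num [Nat.factorial], div_le_iff₀ (by norm_num)] at h
  rw [Real.exp_neg, ← div_eq_mul_inv, div_le_iff₀ (Real.exp_pos _)]
  calc (n : ℝ) = 1 / (n : ℝ) ^ 2 * n ^ 3 := by field_simp
    _ ≤ 1 / (n : ℝ) ^ 2 * (Real.exp (Real.sqrt n) * 720) := by gcongr
    _ = _ := by ring

lemma summable_norm_mul_of_norm_le
    (ha : ∀ r ∈ Ico (0 : ℝ) 1, Summable fun n => ‖a n‖ * r ^ n) {x : ℕ → ℂ}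
    (hx : ∀ᶠ n : ℕ in Filter.atTop, ‖x n‖ ≤ n) {r : ℝ} (hr : r ∈ Ico (0 : ℝ) 1) :
    Summable fun n => ‖a n * x n‖ * r ^ n := by
  have hr0 := hr.1
  refine Summable.of_norm_bounded_eventually_nat (summable_norm_mul_nat_mul_pow ha hr) ?_
  filter_upwards [hx] with n hn
  rw [Real.norm_of_nonneg (by positivity), norm_mul]
  gcongr

open Filter Topology in
/-- The tails of the series `∑ a_n x_n z^n` are negligible as soon as its coefficients have
stretched exponential decay. -/
lemma eventually_norm_tsum_tail_le {x : ℕ → ℂ} (hx : ∀ᶠ n : ℕ in atTop, ‖x n‖ ≤ n) {δ : ℝ}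
    (hδ : 0 < δ) :
    ∀ᶠ N : ℕ in atTop, ∀ z : ℂ, (∀ n, N ≤ n → ‖a n‖ * ‖z‖ ^ n ≤ Real.exp (-Real.sqrt n)) →
      ‖∑' n, a (n + N) * x (n + N) * z ^ (n + N)‖ ≤ δ := by
  obtain ⟨n₀, hn₀⟩ := eventually_atTop.1 hx
  have ht := tendsto_sum_nat_add fun n : ℕ => (n : ℝ) * Real.exp (-Real.sqrt n)
  filter_upwards [ht.eventually_le_const hδ, eventually_ge_atTop n₀] with N hN hN0 z hz
  refine (tsum_of_norm_bounded
    ((summable_nat_add_iff N).2 summable_nat_mul_exp_neg_sqrt).hasSum fun n => ?_).trans hN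
  rw [norm_mul, norm_mul, norm_pow]
  have h1 := hn₀ (n + N) (by omega)
  have h2 := hz (n + N) (by omega)
  calc ‖a (n + N)‖ * ‖x (n + N)‖ * ‖z‖ ^ (n + N) = ‖x (n + N)‖ * (‖a (n + N)‖ * ‖z‖ ^ (n + N)) := by
        ring
    _ ≤ _ := by gcongr

open Filter Topology in
/-- A bound for the partial sums in terms of their quadratic means gives a bound for the maximum
modulus outside the exceptional set. -/
lemma eventually_maxModulus_le
    (ha : ∀ r ∈ Ico (0 : ℝ) 1, Summable fun n => ‖a n‖ * r ^ n) (hne : ∃ m, a m ≠ 0)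
    {E : Set ℝ}
    (hE : ∀ r ∈ Ico (1 / 2 : ℝ) 1, r ∉ E → 1 ≤ Real.log (maxTerm a r / (1 - r)) → ∀ n : ℕ,
        16 * (1 / (1 - r) * Real.log (maxTerm a r / (1 - r))) ^ 2 ≤ n →
          ‖a n‖ * r ^ n ≤ Real.exp (-Real.sqrt n))
    {x : ℕ → ℂ} (hx : ∀ᶠ n : ℕ in atTop, ‖x n‖ ≤ n) {C : ℝ} (hC : 0 < C)
    (hpoly : ∀ᶠ N : ℕ in atTop, ∀ z : ℂ, 1 / 2 ≤ ‖z‖ → ‖z‖ < 1 →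
      ‖∑ n ∈ Finset.range N, a n * x n * z ^ n‖ ≤
        C * Real.sqrt (Real.log (N + 1)) *
          Real.sqrt (∑ n ∈ Finset.range N, ‖a n * z ^ n‖ ^ 2)) :
    ∀ᶠ r in 𝓝[<] (1 : ℝ), r ∉ E → maxModulus (fun z => ∑' n, a n * x n * z ^ n) r ≤
      (2 * C + 1) * Real.sqrt (Real.log (1 / (1 - r) * Real.log (maxTerm a r / (1 - r)))) *
        quadMean a r := by
  -- The tail is made smaller than this fixed positive number, which is at most `S_f(r)` for `r ≥
  -- 1/2`.
  have hδ : 0 < maxTerm a (1 / 2) := maxTerm_pos ha hne ⟨by norm_num, by norm_num⟩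
  obtain ⟨N₀, hN₀⟩ := eventually_atTop.1 (hpoly.and (eventually_norm_tsum_tail_le (a := a) hx hδ))
  -- `L ≥ T ≥ N₀ + 17` ensures `N ≥ N₀` for the cut-off `N` below, and `N + 1 < 16L² + 2 ≤ L³`, so
  -- `log(N+1) ≤ 3 log L`.
  filter_upwards [(tendsto_log_maxTerm_div ha hne).eventually_ge_atTop ((N₀ : ℝ) + 17),
    Ico_mem_nhdsLT (show (1 / 2 : ℝ) < 1 by norm_num)] with r hTN hr hrE
  have hN₀0 : (0 : ℝ) ≤ N₀ := Nat.cast_nonneg _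
  have hEr := hE r hr hrE (by linarith)
  set T := Real.log (maxTerm a r / (1 - r)) with hTdef
  have hr1 : 0 < 1 - r := by linarith [hr.2]
  have hr0 : 0 ≤ r := by linarith [hr.1]
  have hrI : r ∈ Ico (0 : ℝ) 1 := ⟨hr0, hr.2⟩
  set L := 1 / (1 - r) * T with hL
  have hTL : T ≤ L := by
    rw [hL]
    exact le_mul_of_one_le_left (by linarith) (by rw [le_div_iff₀ hr1]; linarith)
  set N := ⌈16 * L ^ 2⌉₊ with hN
  have hNL : 16 * L ^ 2 ≤ N := Nat.le_ceil _
  have hNL' : (N : ℝ) < 16 * L ^ 2 + 1 := Nat.ceil_lt_add_one (by positivity)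
  have hNN₀ : N₀ ≤ N := by
    have : (N₀ : ℝ) ≤ N := by nlinarith
    exact_mod_cast this
  obtain ⟨hp, ht⟩ := hN₀ N hNN₀
  have hlogL : 1 ≤ Real.log L := by
    rw [Real.le_log_iff_exp_le (by linarith)]
    linarith [Real.exp_one_lt_d9]
  have hsL : 1 ≤ Real.sqrt (Real.log L) := Real.one_le_sqrt.2 hlogL
  have hlogN : Real.sqrt (Real.log (N + 1)) ≤ 2 * Real.sqrt (Real.log L) := by
    have h1 : Real.log (N + 1) ≤ 3 * Real.log L := by
      rw [show (3 : ℝ) * Real.log L = Real.log (L ^ 3) by rw [Real.log_pow]; norm_num]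
      refine Real.log_le_log (by positivity) ?_
      nlinarith [sq_nonneg L]
    rw [show (2 : ℝ) * Real.sqrt (Real.log L) = Real.sqrt (2 ^ 2 * Real.log L) by
      rw [Real.sqrt_mul (by positivity), Real.sqrt_sq (by norm_num)]]
    exact Real.sqrt_le_sqrt (by linarith)
  have hQ0 : 0 ≤ quadMean a r := Real.sqrt_nonneg _
  have hδQ : maxTerm a (1 / 2) ≤ quadMean a r :=
    (maxTerm_mono ha (by norm_num) hr.1 hr.2).trans (maxTerm_le_quadMean ha hrI)
  refine Real.sSup_le ?_ (by positivity)
  rintro _ ⟨z, hz, rfl⟩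
  have hzr : ‖z‖ = r := by simpa using hz
  have hsum : Summable fun n => a n * x n * z ^ n :=
    (analyticOnNhd_tsum fun ρ hρ => summable_norm_mul_of_norm_le ha hx hρ).1 z
      (by simpa [hzr] using hr.2)
  have h1 := hp z (hzr ▸ hr.1) (hzr ▸ hr.2)
  have h2 := ht z fun n hn => by
    rw [hzr]
    exact hEr n (hNL.trans (by exact_mod_cast hn))
  have h3 := sqrt_sum_le_quadMean ha hrI hzr (Finset.range N)
  simp only
  rw [← hsum.sum_add_tsum_nat_add N]
  calc _ ≤ C * Real.sqrt (Real.log (N + 1)) *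
          Real.sqrt (∑ n ∈ Finset.range N, ‖a n * z ^ n‖ ^ 2) + maxTerm a (1 / 2) :=
        (norm_add_le _ _).trans (add_le_add h1 h2)
    _ ≤ C * (2 * Real.sqrt (Real.log L)) * quadMean a r +
          Real.sqrt (Real.log L) * quadMean a r := by
        refine add_le_add (by gcongr) (hδQ.trans ?_)
        exact le_mul_of_one_le_left hQ0 hsL
    _ = _ := by ring

end Deterministic

theorem theorem4p4
    {Ω : Type*} [MeasurableSpace Ω] (P : Measure Ω) [IsProbabilityMeasure P]
    (f : ℂ → ℂ) (a : ℕ → ℂ)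
    (hf : AnalyticOnNhd ℂ f (ball (0 : ℂ) 1))
    (hfa : ∀ z ∈ ball (0 : ℂ) 1, HasSum (fun n : ℕ => a n * z ^ n) (f z))
    (hfc : ¬ ∃ c : ℂ, ∀ z ∈ ball (0 : ℂ) 1, f z = c)
    (X : ℕ → Ω → ℂ)
    (hXm : ∀ n, Measurable (X n))
    (hXi : iIndepFun X P)
    (hXc : CentredSeq X P)
    (hXs : SubgaussianSeq X P) :
    (∀ᵐ ω ∂P,
      (∀ z ∈ ball (0 : ℂ) 1, Summable (fun n : ℕ => a n * X n ω * z ^ n)) ∧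
      AnalyticOnNhd ℂ (randomSeries a X ω) (ball (0 : ℂ) 1)) ∧
    ∃ E : Set ℝ, IsOpen E ∧ E ⊆ Ico (0 : ℝ) 1 ∧ FiniteLogMeasure E ∧
      ∃ C : ℝ, 0 < C ∧
        ∀ᵐ ω ∂P, ∃ r₀ ∈ Ioo (0 : ℝ) 1, ∀ r ∈ Ico r₀ 1, r ∉ E →
          maxModulus (randomSeries a X ω) r ≤
            C * Real.sqrt (Real.log (1 / (1 - r) * Real.log (maxTerm a r / (1 - r)))) *
              quadMean a r := by
  have ha : ∀ r ∈ Ico (0 : ℝ) 1, Summable fun n => ‖a n‖ * r ^ n := fun r hr => by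
    have h := (hfa (r : ℂ) (by simpa [abs_of_nonneg hr.1] using hr.2)).summable.norm
    simpa [norm_mul, norm_pow, abs_of_nonneg hr.1] using h
  have hne : ∃ m, a m ≠ 0 := by
    by_contra! h
    refine hfc ⟨0, fun z hz => ?_⟩
    simpa [h] using (hfa z hz).tsum_eq.symm
  have hX := ae_eventually_norm_le hXs
  -- `E` and `C` are fixed before any outcome; only `r₀` depends on `ω`.
  obtain ⟨E, hEo, hE, hEm, hterms⟩ := exists_exceptional_set_terms_le ha hne
  obtain ⟨C, hC, hpoly⟩ := ae_eventually_norm_sum_le a hXm hXi hXc hXs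
  refine ⟨?_, E, hEo, hE, hEm, 2 * C + 1, by positivity, ?_⟩
  · filter_upwards [hX] with ω hω
    exact analyticOnNhd_tsum fun ρ hρ => summable_norm_mul_of_norm_le ha hω hρ
  · filter_upwards [hX, hpoly] with ω hω hpω
    obtain ⟨l, hl, hlr⟩ := (mem_nhdsLT_iff_exists_Ioo_subset).1
      (eventually_maxModulus_le ha hne hterms hω hC hpω)
    obtain ⟨r₀, hr₀, hr₁⟩ := exists_between (max_lt (show l < 1 from hl) zero_lt_one)
    exact ⟨r₀, ⟨(le_max_right _ _).trans_lt hr₀, hr₁⟩, fun r hr hrE =>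
      hlr ⟨((le_max_left _ _).trans_lt hr₀).trans_le hr.1, hr.2⟩ hrE⟩
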